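/- Let $T$ be Thompson's group $T$: the group, under composition, of all orientation preserving homeomorphisms of the circle $\mathbf{S}^1=\mathbf{R}/\mathbf{Z}$ that are piecewise linear with only finitely many breakpoints, all at (images of) dyadic rationals, with slopes all of the form $2^k$, $k\in\mathbf{Z}$, and that map (images of) dyadic rationals to (images of) dyadic rationals. Let $T$ act on $\mathbf{S}^1$ in the natural way and write $T_z$ for the stabilizer of $z\in\mathbf{S}^1$ in $T$. For a subgroup $H$ of a discrete group $G$ and a unitary representation $(\sigma,\mathcal K)$ of $H$, let $\operatorname{Ind}_H^G\sigma$ be the unitary representation of $G$ by left translation, $(\pi(g)F)(x)=F(g^{-1}x)$, on the Hilbert space of maps $F:G\to\mathcal K$ with $F(xh)=\sigma(h^{-1})F(x)$ for all $x\in G$, $h\in H$ and $\sum_{x\in G/H}\|F(x)\|^2<\infty$; and for $g\in G$ let $\sigma^{g}$ be the representation $k\mapsto\sigma(gkg^{-1})$ of $g^{-1}Hg$. Let $\lambda_{G/H}=\operatorname{Ind}_H^G 1_H$ be the quasi-regular representation. Equivalence of representations means unitary equivalence. Subgroups $H,L$ of $G$ are \emph{representation equivalent} if $\lambda_{G/H}$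 and $\lambda_{G/L}$ are unitarily equivalent; they are \emph{weakly conjugate} if their conjugacy classes have the same closure in the space of subgroups of $G$ with the Chabauty topology (the topology induced from the product topology on $\{0,1\}^G$). Let $x,y\in\mathbf{S}^1$. Then: (i) For every finite dimensional irreducible unitary representation $\sigma$ of $T_x$, the representation $\operatorname{Ind}_{T_x}^T\sigma$ is irreducible. (ii) For all finite dimensional irreducible unitary representations $\sigma$ of $T_x$ and $\rho$ of $T_y$, the representations $\operatorname{Ind}_{T_x}^T\sigma$ and $\operatorname{Ind}_{T_y}^T\rho$ are equivalent if and only if there exists $g\in T$ such that $gx=y$ and $\rho$ is equivalent to $\sigma^{g^{-1}}$. (iii) If $y\notin Tx$, then $T_x$ and $T_y$ are not representation equivalent. (iv) If neither $x$ nor $y$ belongs to $\mathbf{Q}/\mathbf{Z}$ (the set of points $e^{2\pi i\theta}$ with $\theta\in\mathbf{Q}$), then $T_x$ and $T_y$ are weakly conjugate. -/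

import Mathlib

open Filter Topology

namespace ThompsonRep

noncomputable section

/-! ### Unitary representations -/

section Representations

variable {G : Type*} [Group G]

/-- A unitary representation is a homomorphism `π : G →* (V ≃ₗᵢ[ℂ] V)` into the unitary group
of a Hilbert space `V`. It is irreducible if `V ≠ 0` and the only closed invariant subspaces are
`0` and `V`. -/
def IsIrreducibleRep {V : Type*} [NormedAddCommGroup V] [InnerProductSpace ℂ V]
    (π : G →* (V ≃ₗᵢ[ℂ] V)) : Prop :=
  Nontrivial V ∧ ∀ W : Submodule ℂ V, IsClosed (W : Set V) →
    (∀ g : G, ∀ v ∈ W, π g v ∈ W) → W = ⊥ ∨ W = ⊤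

/-- Unitary equivalence of two unitary representations of the same group. -/
def UnitarilyEquivalent {V W : Type*} [NormedAddCommGroup V] [InnerProductSpace ℂ V]
    [NormedAddCommGroup W] [InnerProductSpace ℂ W]
    (π : G →* (V ≃ₗᵢ[ℂ] V)) (ρ : G →* (W ≃ₗᵢ[ℂ] W)) : Prop :=
  ∃ U : V ≃ₗᵢ[ℂ] W, ∀ (g : G) (v : V), U (π g v) = ρ g (U v)

/-- For a representation `σ` of `H`, the representation `σ^g` of `L = g⁻¹ H g`, given by
`σ^g(k) = σ(g k g⁻¹)`. -/
def conjRep {K : Type*} [NormedAddCommGroup K] [InnerProductSpace ℂ K] (g : G)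
    {H L : Subgroup G} (hL : L = H.map (MulAut.conj g⁻¹).toMonoidHom)
    (σ : H →* (K ≃ₗᵢ[ℂ] K)) : L →* (K ≃ₗᵢ[ℂ] K) :=
  σ.comp (((MulAut.conj g).toMonoidHom.comp L.subtype).codRestrict H (by
    subst hL
    rintro ⟨k, h, hh, rfl⟩
    have e : g * (g⁻¹ * h * g⁻¹⁻¹) * g⁻¹ = h := by group
    change g * (g⁻¹ * h * g⁻¹⁻¹) * g⁻¹ ∈ H
    rwa [e]))

theorem conjRep_apply {K : Type*} [NormedAddCommGroup K] [InnerProductSpace ℂ K] (g : G)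
    {H L : Subgroup G} (hL : L = H.map (MulAut.conj g⁻¹).toMonoidHom)
    (σ : H →* (K ≃ₗᵢ[ℂ] K)) (k : L) (hk : g * k * g⁻¹ ∈ H) :
    conjRep g hL σ k = σ ⟨g * k * g⁻¹, hk⟩ := rfl

theorem stabilizer_eq_conj {X : Type*} [MulAction G X] {x y : X} {g : G} (h : g • x = y) :
    MulAction.stabilizer G y =
      (MulAction.stabilizer G x).map (MulAut.conj (g⁻¹)⁻¹).toMonoidHom := by
  subst h
  rw [inv_inv]
  exact MulAction.stabilizer_smul_eq_stabilizer_map_conj g x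

/-! ### Induced representations -/

variable {H : Subgroup G} {K : Type*} [NormedAddCommGroup K] [InnerProductSpace ℂ K]

theorem memlp_two_iff {ι E : Type*} [NormedAddCommGroup E] {f : ι → E} :
    Memℓp f 2 ↔ Summable fun i => ‖f i‖ ^ 2 := by
  rw [memℓp_gen_iff (by norm_num)]
  simp

/-- The maps `F : G → K` with `F (x h) = σ(h⁻¹) F(x)` for `h ∈ H`, and
`∑_{x ∈ G/H} ‖F x‖² < ∞`; since `‖F x‖` depends only on the coset of `x`, the sum is taken over
a set of representatives (see `norm_out`). -/
def indSubmodule (σ : H →* (K ≃ₗᵢ[ℂ] K)) : Submodule ℂ (G → K) where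
  carrier := {F | (∀ (x : G) (h : H), F (x * h) = σ h⁻¹ (F x)) ∧
    Summable fun q : G ⧸ H => ‖F q.out‖ ^ 2}
  add_mem' := by
    rintro F₁ F₂ ⟨h₁, s₁⟩ ⟨h₂, s₂⟩
    exact ⟨fun x h => by simp [h₁ x h, h₂ x h],
      memlp_two_iff.1 ((memlp_two_iff.2 s₁).add (memlp_two_iff.2 s₂))⟩
  zero_mem' := ⟨fun x h => by simp, by simp⟩
  smul_mem' := by
    rintro c F ⟨h₁, s₁⟩
    exact ⟨fun x h => by simp [h₁ x h], memlp_two_iff.1 ((memlp_two_iff.2 s₁).const_smul c)⟩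

/-- The Hilbert space of the induced representation. -/
def IndSpace (σ : H →* (K ≃ₗᵢ[ℂ] K)) : Type _ := indSubmodule σ

namespace IndSpace

variable (σ : H →* (K ≃ₗᵢ[ℂ] K))

instance : AddCommGroup (IndSpace σ) := inferInstanceAs (AddCommGroup (indSubmodule σ))

instance : Module ℂ (IndSpace σ) := inferInstanceAs (Module ℂ (indSubmodule σ))

variable {σ}

/-- The underlying map `G → K`. -/
def toFun (F : IndSpace σ) : G → K := Subtype.val F

theorem toFun_injective : Function.Injective (toFun : IndSpace σ → G → K) :=
  Subtype.val_injective

theorem map_mul (F : IndSpace σ) (x : G) (h : H) : F.toFun (x * h) = σ h⁻¹ (F.toFun x) :=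
  F.2.1 x h

theorem apply_eq (F : IndSpace σ) (x : G) :
    F.toFun x = σ ⟨x⁻¹ * (x : G ⧸ H).out, QuotientGroup.eq.1 (by simp)⟩
      (F.toFun (x : G ⧸ H).out) := by
  have hm : (x : G ⧸ H).out⁻¹ * x ∈ H := QuotientGroup.eq.1 (by simp)
  have := F.map_mul (x : G ⧸ H).out ⟨_, hm⟩
  simp only [mul_inv_cancel_left] at this
  rw [this]
  congr 2
  ext
  simp

theorem norm_out (F : IndSpace σ) (x : G) : ‖F.toFun (x : G ⧸ H).out‖ = ‖F.toFun x‖ := by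
  rw [F.apply_eq x, LinearIsometryEquiv.norm_map]

variable (σ)

/-- Restriction of `F` to a set of representatives of `G/H`. -/
def restr : IndSpace σ →ₗ[ℂ] lp (fun _ : G ⧸ H => K) 2 where
  toFun F := ⟨fun q => F.toFun q.out, memlp_two_iff.2 F.2.2⟩
  map_add' _ _ := rfl
  map_smul' _ _ := rfl

theorem restr_apply (F : IndSpace σ) (q : G ⧸ H) : restr σ F q = F.toFun q.out := rfl

theorem restr_injective : Function.Injective (restr σ) := by
  intro F₁ F₂ h
  apply toFun_injective
  funext x
  rw [F₁.apply_eq, F₂.apply_eq, ← restr_apply σ F₁, ← restr_apply σ F₂, h]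

theorem restr_surjective : Function.Surjective (restr σ) := by
  intro v
  have hm : ∀ x : G, x⁻¹ * (x : G ⧸ H).out ∈ H := fun x => QuotientGroup.eq.1 (by simp)
  have hout : ∀ q : G ⧸ H, σ ⟨q.out⁻¹ * ((q.out : G) : G ⧸ H).out, hm _⟩
      (v ((q.out : G) : G ⧸ H)) = v q := by
    intro q
    have : (⟨q.out⁻¹ * ((q.out : G) : G ⧸ H).out, hm _⟩ : H) = 1 := by
      ext; simp
    rw [this, map_one, QuotientGroup.out_eq']
    rfl
  refine ⟨⟨fun x => σ ⟨x⁻¹ * (x : G ⧸ H).out, hm x⟩ (v (x : G ⧸ H)), ?_, ?_⟩, ?_⟩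
  · intro x h
    have hq : ((x * h : G) : G ⧸ H) = x := by simp
    change σ ⟨(x * h)⁻¹ * ((x * h : G) : G ⧸ H).out, hm (x * h)⟩ (v ((x * h : G) : G ⧸ H)) =
      (σ h⁻¹ * σ ⟨x⁻¹ * (x : G ⧸ H).out, hm x⟩) (v (x : G ⧸ H))
    rw [← _root_.map_mul]
    have e : (⟨(x * h)⁻¹ * ((x * h : G) : G ⧸ H).out, hm (x * h)⟩ : H) =
        h⁻¹ * ⟨x⁻¹ * (x : G ⧸ H).out, hm x⟩ := by
      ext
      simp [hq, mul_assoc]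
    rw [e, hq]
  · simp only [hout]
    exact memlp_two_iff.1 v.2
  · ext q
    exact hout q

/-- The norm, with `‖F‖² = ∑_{x ∈ G/H} ‖F x‖²`. -/
instance : NormedAddCommGroup (IndSpace σ) :=
  NormedAddCommGroup.induced (IndSpace σ) (lp (fun _ : G ⧸ H => K) 2) (restr σ)
    (restr_injective σ)

/-- The inner product `⟨F₁, F₂⟩ = ∑_{x ∈ G/H} ⟨F₁ x, F₂ x⟩`. -/
instance : InnerProductSpace ℂ (IndSpace σ) where
  norm_smul_le c F := by
    change ‖restr σ (c • F)‖ ≤ ‖c‖ * ‖restr σ F‖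
    rw [map_smul, norm_smul]
  inner F₁ F₂ := inner ℂ (restr σ F₁) (restr σ F₂)
  norm_sq_eq_re_inner F := norm_sq_eq_re_inner (restr σ F)
  conj_inner_symm F₁ F₂ := inner_conj_symm (restr σ F₁) (restr σ F₂)
  add_left F₁ F₂ F₃ := by rw [map_add, inner_add_left]
  smul_left F₁ F₂ c := by rw [map_smul, inner_smul_left]

theorem inner_eq_tsum (F₁ F₂ : IndSpace σ) :
    inner ℂ F₁ F₂ = ∑' q : G ⧸ H, inner ℂ (F₁.toFun q.out) (F₂.toFun q.out) := rfl

theorem norm_sq_eq_tsum (F : IndSpace σ) :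
    ‖F‖ ^ 2 = ∑' q : G ⧸ H, ‖F.toFun q.out‖ ^ 2 := by
  have := lp.norm_rpow_eq_tsum (p := 2) (by norm_num) (restr σ F)
  simp only [ENNReal.toReal_ofNat, Real.rpow_ofNat] at this
  exact this

instance [CompleteSpace K] : CompleteSpace (IndSpace σ) := by
  have hi : Isometry (restr σ) := AddMonoidHomClass.isometry_of_norm _ fun _ => rfl
  exact (completeSpace_congr (e := Equiv.ofBijective _ ⟨restr_injective σ, restr_surjective σ⟩)
    hi.isUniformEmbedding).2 inferInstance

theorem coe_mul_out (g : G) (q : G ⧸ H) : ((g * q.out : G) : G ⧸ H) = g • q := by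
  conv_rhs => rw [← QuotientGroup.out_eq' q]
  rfl

theorem summable_translate (F : IndSpace σ) (g : G) :
    Summable fun q : G ⧸ H => ‖F.toFun (g * q.out)‖ ^ 2 := by
  have h := (MulAction.toPerm g : Equiv.Perm (G ⧸ H)).summable_iff.2 F.2.2
  refine h.congr fun q => ?_
  rw [← F.norm_out (g * q.out), coe_mul_out]
  rfl

/-- Left translation `(π(g) F)(x) = F(g⁻¹ x)`. -/
def translate (g : G) : IndSpace σ →ₗ[ℂ] IndSpace σ where
  toFun F := ⟨fun x => F.toFun (g⁻¹ * x),
    fun x h => by simpa only [mul_assoc] using F.map_mul (g⁻¹ * x) h, F.summable_translate σ g⁻¹⟩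
  map_add' _ _ := rfl
  map_smul' _ _ := rfl

theorem translate_apply (g : G) (F : IndSpace σ) (x : G) :
    (translate σ g F).toFun x = F.toFun (g⁻¹ * x) := rfl

theorem translate_mul (g h : G) (F : IndSpace σ) :
    translate σ (g * h) F = translate σ g (translate σ h F) := by
  apply toFun_injective
  funext x
  simp [translate_apply, mul_assoc]

theorem translate_one (F : IndSpace σ) : translate σ 1 F = F := by
  apply toFun_injective
  funext x
  simp [translate_apply]

theorem norm_translate (g : G) (F : IndSpace σ) : ‖translate σ g F‖ = ‖F‖ := by
  rw [← sq_eq_sq₀ (norm_nonneg _) (norm_nonneg _), norm_sq_eq_tsum, norm_sq_eq_tsum,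
    ← (MulAction.toPerm g⁻¹ : Equiv.Perm (G ⧸ H)).tsum_eq fun q => ‖F.toFun q.out‖ ^ 2]
  refine tsum_congr fun q => ?_
  rw [translate_apply, ← F.norm_out (g⁻¹ * q.out)]
  rw [coe_mul_out]
  rfl

end IndSpace

/-- The induced representation `Ind_H^G σ`, acting by left translation on `IndSpace σ`. -/
def ind (σ : H →* (K ≃ₗᵢ[ℂ] K)) : G →* (IndSpace σ ≃ₗᵢ[ℂ] IndSpace σ) where
  toFun g :=
    { IndSpace.translate σ g with
      invFun := IndSpace.translate σ g⁻¹
      left_inv := fun F => by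
        change IndSpace.translate σ g⁻¹ (IndSpace.translate σ g F) = F
        rw [← IndSpace.translate_mul, inv_mul_cancel, IndSpace.translate_one]
      right_inv := fun F => by
        change IndSpace.translate σ g (IndSpace.translate σ g⁻¹ F) = F
        rw [← IndSpace.translate_mul, mul_inv_cancel, IndSpace.translate_one]
      norm_map' := IndSpace.norm_translate σ g }
  map_one' := by
    ext F : 1
    exact IndSpace.translate_one σ F
  map_mul' g h := by
    ext F : 1
    exact IndSpace.translate_mul σ g h F

theorem ind_apply (σ : H →* (K ≃ₗᵢ[ℂ] K)) (g : G) (F : IndSpace σ) (x : G) :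
    (ind σ g F).toFun x = F.toFun (g⁻¹ * x) := rfl

variable (H)

/-- The quasi-regular representation `λ_{G/H} = Ind_H^G 1_H`. -/
def quasiRegular : G →* (IndSpace (1 : H →* (ℂ ≃ₗᵢ[ℂ] ℂ)) ≃ₗᵢ[ℂ] IndSpace (1 : H →* (ℂ ≃ₗᵢ[ℂ] ℂ))) :=
  ind (1 : H →* (ℂ ≃ₗᵢ[ℂ] ℂ))

/-! ### Relations between subgroups -/

/-- Subgroups are representation equivalent if their quasi-regular representations are unitarily
equivalent. -/
def RepEquivalent (H L : Subgroup G) : Prop :=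
  UnitarilyEquivalent (quasiRegular H) (quasiRegular L)

open scoped Classical in
/-- The Chabauty topology on the set of subgroups of a discrete group: the topology induced from
the product topology on `{0,1}^G` by `H ↦ 1_H`. -/
@[reducible]
def chabauty (G : Type*) [Group G] : TopologicalSpace (Subgroup G) :=
  TopologicalSpace.induced (fun (H : Subgroup G) (g : G) => decide (g ∈ H))
    (inferInstance : TopologicalSpace (G → Bool))

/-- The conjugacy class of a subgroup. -/
def conjClass (H : Subgroup G) : Set (Subgroup G) :=
  Set.range fun g : G => H.map (MulAut.conj g).toMonoidHom

/-- Subgroups are weakly conjugate if their conjugacy classes have the same closure in the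
Chabauty topology. -/
def WeaklyConjugate (H L : Subgroup G) : Prop :=
  closure[chabauty G] (conjClass H) = closure[chabauty G] (conjClass L)

end Representations

/-! ### Thompson's group `T` -/

/-- The images in `ℝ/ℤ` of the dyadic rationals. -/
def dyadicPoints : Set UnitAddCircle :=
  {z | ∃ (m : ℤ) (n : ℕ), z = (((m : ℝ) / 2 ^ n : ℝ) : UnitAddCircle)}

/-- The images in `ℝ/ℤ` of the rationals. -/
def rationalPoints : Set UnitAddCircle :=
  {z | ∃ q : ℚ, z = ((q : ℝ) : UnitAddCircle)}

/-- `f` is affine near `t`, with slope a power of `2`. -/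
def AffineNear (f : ℝ → ℝ) (t : ℝ) : Prop :=
  ∃ (k : ℤ) (c : ℝ), ∀ᶠ s in 𝓝 t, f s = (2 : ℝ) ^ k * s + c

/-- The condition for a homeomorphism `g` of the circle `ℝ/ℤ` to belong to Thompson's group `T`:
it is orientation preserving, i.e. lifts to an increasing bijection `f` of `ℝ` commuting with
`t ↦ t + 1`; outside a finite set `B` of dyadic points it is locally affine with slopes powers
of `2`; and it maps dyadic points to dyadic points. -/
def IsThompson (g : UnitAddCircle ≃ₜ UnitAddCircle) : Prop :=
  (∃ f : ℝ ≃o ℝ, (∀ t, f (t + 1) = f t + 1) ∧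
    (∀ t : ℝ, ((f t : ℝ) : UnitAddCircle) = g (t : UnitAddCircle)) ∧
    ∃ B : Set UnitAddCircle, B.Finite ∧ B ⊆ dyadicPoints ∧
      ∀ t : ℝ, (t : UnitAddCircle) ∉ B → AffineNear f t) ∧
  ∀ z ∈ dyadicPoints, g z ∈ dyadicPoints

theorem AffineNear.comp {f₁ f₂ : ℝ → ℝ} {t : ℝ} (h₁ : AffineNear f₁ (f₂ t))
    (h₂ : AffineNear f₂ t) (hc : ContinuousAt f₂ t) : AffineNear (fun s => f₁ (f₂ s)) t := by
  obtain ⟨k, c, h₁⟩ := h₁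
  obtain ⟨l, d, h₂⟩ := h₂
  refine ⟨k + l, 2 ^ k * d + c, ?_⟩
  filter_upwards [hc.eventually h₁, h₂] with s hs hs'
  rw [hs, hs', zpow_add₀ two_ne_zero]
  ring

theorem AffineNear.symm {f : ℝ ≃o ℝ} {t : ℝ} (h : AffineNear f (f.symm t)) :
    AffineNear f.symm t := by
  obtain ⟨k, c, h⟩ := h
  refine ⟨-k, -(2 ^ (-k) * c), ?_⟩
  filter_upwards [f.symm.continuous.continuousAt.eventually h] with s hs
  rw [OrderIso.apply_symm_apply] at hs
  have e : (2 : ℝ) ^ (-k) * 2 ^ k = 1 := by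
    rw [← zpow_add₀ two_ne_zero, neg_add_cancel, zpow_zero]
  linear_combination (2 : ℝ) ^ (-k) * (-hs) - f.symm s * e

theorem mem_dyadicPoints_iff {t : ℝ} : (t : UnitAddCircle) ∈ dyadicPoints ↔
    ∃ (m : ℤ) (n : ℕ), t = m / 2 ^ n := by
  constructor
  · rintro ⟨m, n, h⟩
    rw [← sub_eq_zero, ← AddCircle.coe_sub, AddCircle.coe_eq_zero_iff] at h
    obtain ⟨j, hj⟩ := h
    refine ⟨m + j * 2 ^ n, n, ?_⟩
    simp only [zsmul_eq_mul, mul_one] at hj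
    push_cast
    field_simp
    field_simp at hj
    linarith
  · rintro ⟨m, n, rfl⟩
    exact ⟨m, n, rfl⟩

theorem dyadic_sub {s t : ℝ} (hs : ∃ (m : ℤ) (n : ℕ), s = m / 2 ^ n)
    (ht : ∃ (m : ℤ) (n : ℕ), t = m / 2 ^ n) : ∃ (m : ℤ) (n : ℕ), s - t = m / 2 ^ n := by
  obtain ⟨m, n, rfl⟩ := hs
  obtain ⟨m', n', rfl⟩ := ht
  refine ⟨m * 2 ^ n' - m' * 2 ^ n, n + n', ?_⟩
  push_cast
  field_simp
  ring

theorem dyadic_zpow_mul {s : ℝ} (hs : ∃ (m : ℤ) (n : ℕ), s = m / 2 ^ n) (k : ℤ) :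
    ∃ (m : ℤ) (n : ℕ), (2 : ℝ) ^ k * s = m / 2 ^ n := by
  obtain ⟨m, n, rfl⟩ := hs
  obtain ⟨l, rfl | rfl⟩ := k.eq_nat_or_neg
  · refine ⟨2 ^ l * m, n, ?_⟩
    push_cast
    rw [zpow_natCast]
    ring
  · refine ⟨m, l + n, ?_⟩
    rw [zpow_neg, zpow_natCast]
    field_simp
    ring

theorem exists_dyadic_near {P : ℝ → Prop} {t : ℝ} (h : ∀ᶠ s in 𝓝 t, P s) :
    ∃ s, P s ∧ ∃ (m : ℤ) (n : ℕ), s = m / 2 ^ n := by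
  obtain ⟨ε, hε, h⟩ := Metric.eventually_nhds_iff.1 h
  obtain ⟨n, hn⟩ := exists_pow_lt_of_lt_one hε (by norm_num : (1 / 2 : ℝ) < 1)
  refine ⟨⌊t * 2 ^ n⌋ / 2 ^ n, h ?_, _, _, rfl⟩
  have h₁ := Int.floor_le (t * 2 ^ n)
  have h₂ := Int.lt_floor_add_one (t * 2 ^ n)
  have hp : (0 : ℝ) < 2 ^ n := by positivity
  refine lt_of_le_of_lt ?_ hn
  rw [Real.dist_eq, abs_sub_comm, abs_of_nonneg (by rw [sub_nonneg, div_le_iff₀ hp]; exact h₁),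
    one_div, inv_pow, sub_le_iff_le_add, ← one_div, ← add_div, le_div_iff₀ hp]
  linarith

theorem IsThompson.inv {g : UnitAddCircle ≃ₜ UnitAddCircle} (hg : IsThompson g) :
    IsThompson g⁻¹ := by
  obtain ⟨⟨f, f1, fg, B, hB, hBd, hf⟩, hd⟩ := hg
  have fg' : ∀ t : ℝ, ((f.symm t : ℝ) : UnitAddCircle) = g⁻¹ (t : UnitAddCircle) := by
    intro t
    apply g.injective
    rw [← fg, OrderIso.apply_symm_apply]
    exact (g.apply_symm_apply _).symm
  refine ⟨⟨f.symm, fun t => ?_, fg', g '' B, hB.image _, ?_, fun t ht => ?_⟩, fun z hz => ?_⟩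
  · apply f.injective
    rw [f1, OrderIso.apply_symm_apply, OrderIso.apply_symm_apply]
  · rintro _ ⟨z, hz, rfl⟩
    exact hd z (hBd hz)
  · refine AffineNear.symm (hf _ fun h => ht ⟨_, h, ?_⟩)
    rw [← fg, OrderIso.apply_symm_apply]
  · obtain ⟨t, rfl⟩ := QuotientAddGroup.mk_surjective z
    by_cases hb : ((f.symm t : ℝ) : UnitAddCircle) ∈ B
    · have := hBd hb
      rwa [fg'] at this
    · obtain ⟨k, c, hk⟩ := hf _ hb
      obtain ⟨s, hs, hsd⟩ := exists_dyadic_near hk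
      have hfs : ∃ (m : ℤ) (n : ℕ), f s = m / 2 ^ n := by
        rw [← mem_dyadicPoints_iff, fg]
        exact hd _ (mem_dyadicPoints_iff.2 hsd)
      have ht := hk.self_of_nhds
      rw [OrderIso.apply_symm_apply] at ht
      have e : f.symm t = s - 2 ^ (-k) * (f s - t) := by
        have e : (2 : ℝ) ^ (-k) * 2 ^ k = 1 := by
          rw [← zpow_add₀ two_ne_zero, neg_add_cancel, zpow_zero]
        linear_combination (2 : ℝ) ^ (-k) * (hs - ht) + (s - f.symm t) * e
      have hz' := mem_dyadicPoints_iff.1 hz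
      have := mem_dyadicPoints_iff.2 (dyadic_sub hsd (dyadic_zpow_mul (dyadic_sub hfs hz') (-k)))
      rwa [← e, fg'] at this

/-- Thompson's group `T`. -/
def thompsonT : Subgroup (UnitAddCircle ≃ₜ UnitAddCircle) where
  carrier := {g | IsThompson g}
  one_mem' := ⟨⟨OrderIso.refl ℝ, fun _ => rfl, fun _ => rfl, ∅, Set.finite_empty,
    Set.empty_subset _, fun _ _ => ⟨0, 0, by simp⟩⟩, fun _ hz => hz⟩
  mul_mem' := by
    rintro g₁ g₂ ⟨⟨f₁, a₁, b₁, B₁, c₁, d₁, e₁⟩, h₁⟩ hg₂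
    obtain ⟨-, h₂'⟩ := hg₂.inv
    obtain ⟨⟨f₂, a₂, b₂, B₂, c₂, d₂, e₂⟩, h₂⟩ := hg₂
    refine ⟨⟨f₂.trans f₁, fun t => ?_, fun t => ?_, B₂ ∪ g₂.symm '' B₁, c₂.union (c₁.image _), ?_,
      fun t ht => ?_⟩, fun z hz => h₁ _ (h₂ z hz)⟩
    · simp [a₁, a₂]
    · simp only [OrderIso.trans_apply, b₁, b₂]
      rfl
    · rintro z (hz | ⟨w, hw, rfl⟩)
      · exact d₂ hz
      · exact h₂' _ (d₁ hw)
    · have h₃ : ((f₂ t : ℝ) : UnitAddCircle) ∉ B₁ := fun h =>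
        ht (Or.inr ⟨_, h, by rw [b₂]; exact g₂.symm_apply_apply _⟩)
      exact AffineNear.comp (f₂ := f₂) (e₁ _ h₃) (e₂ t fun h => ht (Or.inl h))
        f₂.continuous.continuousAt
  inv_mem' := IsThompson.inv

/-- The action of `T` on the circle. -/
instance : MulAction thompsonT UnitAddCircle where
  smul g z := (g : UnitAddCircle ≃ₜ UnitAddCircle) z
  one_smul _ := rfl
  mul_smul _ _ _ := rfl

theorem smul_def (g : thompsonT) (z : UnitAddCircle) :
    g • z = (g : UnitAddCircle ≃ₜ UnitAddCircle) z := rfl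

end

end ThompsonRep

open ThompsonRep

namespace ThompsonRep

noncomputable section

/-! ### Schur's lemma for finite dimensional unitary representations -/

section Schur

variable {G : Type*} [Group G] {V W : Type*} [NormedAddCommGroup V] [InnerProductSpace ℂ V]
  [NormedAddCommGroup W] [InnerProductSpace ℂ W]

/-! Parts (i)–(iii) follow Mackey's method. With `H = T_x` and `L = T_y`, an intertwiner `A : Ind σ
→ Ind ρ` is determined by its values on functions supported on `H`, hence by the operators `coeff A
g : K → K'`, which are equivariant under `H` on the left and `L` on the right. Square summability
over `G/L` forces `coeff A g = 0` as soon as the `H`-orbit of `gL` is infinite (`coeff_eq_zero`).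
Here `G/L` is the orbit of `y`, and every `T_x`-orbit other than `{x}` is infinite
(`exists_injective_stabilizer_smul`), so a coefficient can survive only where `g • y = x`.

If `ρ = σ`, the coefficient at `1` is scalar by Schur's lemma, so the projection onto an invariant
subspace is scalar. In general, a surviving coefficient intertwines a conjugate of `σ` with `ρ`, and
Schur's lemma makes it a multiple of a unitary; for trivial `σ` and `ρ`, its mere existence puts `y`
in the orbit of `x`.

For (iv), an element of `T` fixing an irrational point is the identity near it
(`eventually_smul_eq_self`). Hence `z ↦ T_z` is continuous at irrational points, and density of the
orbits gives the equality of closures. -/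

theorem rep_mul_apply (π : G →* (V ≃ₗᵢ[ℂ] V)) (g h : G) (v : V) : π (g * h) v = π g (π h v) := by
  rw [map_mul]; rfl

theorem rep_one_apply (π : G →* (V ≃ₗᵢ[ℂ] V)) (v : V) : π 1 v = v := by
  rw [map_one]; rfl

theorem rep_inv_apply_apply (π : G →* (V ≃ₗᵢ[ℂ] V)) (g : G) (v : V) : π g⁻¹ (π g v) = v := by
  rw [← rep_mul_apply, inv_mul_cancel, rep_one_apply]

theorem inner_rep_left (π : G →* (V ≃ₗᵢ[ℂ] V)) (g : G) (v w : V) :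
    inner ℂ (π g v) w = inner ℂ v (π g⁻¹ w) := by
  rw [← (π g⁻¹).inner_map_map (π g v) w, rep_inv_apply_apply]

theorem UnitarilyEquivalent.symm {π : G →* (V ≃ₗᵢ[ℂ] V)} {ρ : G →* (W ≃ₗᵢ[ℂ] W)}
    (h : UnitarilyEquivalent π ρ) : UnitarilyEquivalent ρ π := by
  obtain ⟨U, hU⟩ := h
  refine ⟨U.symm, fun g w => U.injective ?_⟩
  rw [hU, U.apply_symm_apply, U.apply_symm_apply]

theorem IsIrreducibleRep.exists_eq_smul [FiniteDimensional ℂ V] {π : G →* (V ≃ₗᵢ[ℂ] V)}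
    (hπ : IsIrreducibleRep π) (B : V →ₗ[ℂ] V) (hB : ∀ g v, B (π g v) = π g (B v)) :
    ∃ c : ℂ, ∀ v, B v = c • v := by
  obtain ⟨_, hW⟩ := hπ
  obtain ⟨c, hc⟩ := Module.End.exists_eigenvalue B
  refine ⟨c, fun v => ?_⟩
  have htop : Module.End.eigenspace B c = ⊤ := by
    refine (hW _ (Submodule.closed_of_finiteDimensional _) fun g v hv => ?_).resolve_left hc
    rw [Module.End.mem_eigenspace_iff] at hv ⊢
    rw [hB, hv, map_smul]
  rw [← Module.End.mem_eigenspace_iff, htop]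
  trivial

/-- Schur's lemma makes `B*B` a scalar `c > 0`, so `B / √c` is isometric; it is onto because the
range of `B` is invariant. -/
theorem IsIrreducibleRep.unitarilyEquivalent_of_intertwiner [FiniteDimensional ℂ V]
    [FiniteDimensional ℂ W] {π : G →* (V ≃ₗᵢ[ℂ] V)} {ρ : G →* (W ≃ₗᵢ[ℂ] W)}
    (hπ : IsIrreducibleRep π) (hρ : IsIrreducibleRep ρ) (B : V →ₗ[ℂ] W)
    (hB : ∀ g v, B (π g v) = ρ g (B v)) (hB0 : B ≠ 0) : UnitarilyEquivalent π ρ := by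
  obtain ⟨c, hc⟩ := hπ.exists_eq_smul (LinearMap.adjoint B ∘ₗ B) fun g v => by
    refine ext_inner_left ℂ fun w => ?_
    simp only [LinearMap.comp_apply]
    rw [LinearMap.adjoint_inner_right, hB, ← inv_inv g, ← inner_rep_left, ← hB,
      ← inner_rep_left, LinearMap.adjoint_inner_right]
  have hnorm : ∀ v, ‖B v‖ ^ 2 = c.re * ‖v‖ ^ 2 := fun v => by
    have h1 : inner ℂ v ((LinearMap.adjoint B ∘ₗ B) v) = ((‖B v‖ ^ 2 : ℝ) : ℂ) := by
      rw [LinearMap.comp_apply, LinearMap.adjoint_inner_right, inner_self_eq_norm_sq_to_K]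
      simp
    rw [hc, inner_smul_right, inner_self_eq_norm_sq_to_K] at h1
    have h2 := congrArg Complex.re h1
    rw [Complex.ofReal_re] at h2
    rw [← h2]
    simp [← Complex.ofReal_pow]
  have hcpos : 0 < c.re := by
    obtain ⟨v, hv⟩ : ∃ v, B v ≠ 0 := by
      by_contra! h
      exact hB0 (LinearMap.ext h)
    have h1 : 0 < c.re * ‖v‖ ^ 2 := by
      rw [← hnorm]
      have := norm_pos_iff.2 hv
      positivity
    exact pos_of_mul_pos_left h1 (by positivity)
  have hsurj : Function.Surjective B := by
    rw [← LinearMap.range_eq_top]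
    refine (hρ.2 _ (Submodule.closed_of_finiteDimensional _) ?_).resolve_left
      fun h => hB0 (LinearMap.range_eq_bot.1 h)
    rintro g _ ⟨v, rfl⟩
    exact ⟨π g v, hB g v⟩
  have hs : (0 : ℝ) < √c.re := Real.sqrt_pos.2 hcpos
  let U : V →ₗᵢ[ℂ] W :=
    { toLinearMap := (((√c.re)⁻¹ : ℝ) : ℂ) • B
      norm_map' := fun v => by
        rw [← sq_eq_sq₀ (norm_nonneg _) (norm_nonneg _), LinearMap.smul_apply, norm_smul, mul_pow,
          hnorm, Complex.norm_real, norm_inv, Real.norm_of_nonneg hs.le, inv_pow,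
          Real.sq_sqrt hcpos.le, inv_mul_cancel_left₀ hcpos.ne'] }
  have hU : ∀ v, U v = (((√c.re)⁻¹ : ℝ) : ℂ) • B v := fun _ => rfl
  have hUsurj : Function.Surjective U := fun w => by
    obtain ⟨v, rfl⟩ := hsurj w
    refine ⟨(√c.re : ℂ) • v, ?_⟩
    rw [hU, map_smul, smul_smul, ← Complex.ofReal_mul, inv_mul_cancel₀ hs.ne', Complex.ofReal_one,
      one_smul]
  refine ⟨LinearIsometryEquiv.ofSurjective U hUsurj, fun g v => ?_⟩
  rw [LinearIsometryEquiv.coe_ofSurjective, hU, hU, hB, map_smul]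

end Schur

/-! ### Intertwiners between induced representations -/

section Intertwiners

variable {G : Type*} [Group G] {H L : Subgroup G}
  {K : Type*} [NormedAddCommGroup K] [InnerProductSpace ℂ K]
  {K' : Type*} [NormedAddCommGroup K'] [InnerProductSpace ℂ K']
  {σ : H →* (K ≃ₗᵢ[ℂ] K)} {ρ : L →* (K' ≃ₗᵢ[ℂ] K')}

/-- The two representations have the same operators, indexed differently, hence the same invariant
subspaces. -/
theorem isIrreducibleRep_conjRep (g : G) (hL : L = H.map (MulAut.conj g⁻¹).toMonoidHom)
    (hσ : IsIrreducibleRep σ) : IsIrreducibleRep (conjRep g hL σ) := by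
  refine ⟨hσ.1, fun W hW hinv => hσ.2 W hW fun h v hv => ?_⟩
  have hk : g⁻¹ * h * g⁻¹⁻¹ ∈ L := by
    rw [hL]
    exact ⟨h, h.2, rfl⟩
  have e : g * (g⁻¹ * h * g⁻¹⁻¹) * g⁻¹ = h := by group
  have := hinv ⟨_, hk⟩ v hv
  rw [conjRep_apply g hL σ ⟨_, hk⟩ (by rw [e]; exact h.2)] at this
  simpa only [e] using this

namespace IndSpace

theorem toFun_add (F₁ F₂ : IndSpace σ) (x : G) :
    (F₁ + F₂).toFun x = F₁.toFun x + F₂.toFun x := rfl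

theorem toFun_smul (c : ℂ) (F : IndSpace σ) (x : G) : (c • F).toFun x = c • F.toFun x := rfl

theorem ext_toFun {F₁ F₂ : IndSpace σ} (h : ∀ x, F₁.toFun x = F₂.toFun x) : F₁ = F₂ :=
  toFun_injective (funext h)

variable (σ)

open scoped Classical in
/-- The element of the induced representation space supported on `H` with value `v` at `1`. -/
def single : K →ₗ[ℂ] IndSpace σ where
  toFun v := ⟨fun x => if hx : x ∈ H then σ ⟨x, hx⟩⁻¹ v else 0, by
    intro x h
    by_cases hx : x ∈ H
    · have hxh : x * h ∈ H := H.mul_mem hx h.2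
      have e : (⟨x * h, hxh⟩ : H) = ⟨x, hx⟩ * h := rfl
      simp only [dif_pos hx, dif_pos hxh]
      rw [e, mul_inv_rev, rep_mul_apply]
    · have hxh : x * h ∉ H := fun h' => hx ((Subgroup.mul_mem_cancel_right H h.2).1 h')
      simp only [dif_neg hx, dif_neg hxh, map_zero], by
    refine summable_of_ne_finset_zero (s := {((1 : G) : G ⧸ H)}) fun q hq => ?_
    beta_reduce
    rw [dif_neg, norm_zero, zero_pow two_ne_zero]
    intro h
    apply hq
    rw [Finset.mem_singleton, ← QuotientGroup.out_eq' q, eq_comm, QuotientGroup.eq]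
    simpa using h⟩
  map_add' v w := by
    refine ext_toFun fun x => ?_
    change (if hx : x ∈ H then σ ⟨x, hx⟩⁻¹ (v + w) else 0) =
      (if hx : x ∈ H then σ ⟨x, hx⟩⁻¹ v else 0) + (if hx : x ∈ H then σ ⟨x, hx⟩⁻¹ w else 0)
    split_ifs <;> simp
  map_smul' c v := by
    refine ext_toFun fun x => ?_
    change (if hx : x ∈ H then σ ⟨x, hx⟩⁻¹ (c • v) else 0) =
      c • (if hx : x ∈ H then σ ⟨x, hx⟩⁻¹ v else 0)
    split_ifs <;> simp

theorem single_of_mem (v : K) {x : G} (hx : x ∈ H) :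
    (single σ v).toFun x = σ ⟨x, hx⟩⁻¹ v := dif_pos hx

theorem single_of_notMem (v : K) {x : G} (hx : x ∉ H) : (single σ v).toFun x = 0 := dif_neg hx

theorem single_one (v : K) : (single σ v).toFun 1 = v := by
  rw [single_of_mem σ v H.one_mem, show (⟨1, H.one_mem⟩ : H)⁻¹ = 1 from inv_one, rep_one_apply]

theorem ind_single (h : H) (v : K) : ind σ (h : G) (single σ v) = single σ (σ h v) := by
  refine ext_toFun fun x => ?_
  rw [ind_apply]
  by_cases hx : x ∈ H
  · have hx' : (h : G)⁻¹ * x ∈ H := H.mul_mem (H.inv_mem h.2) hx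
    rw [single_of_mem σ v hx', single_of_mem σ _ hx, ← rep_mul_apply]
    congr 2
    ext
    simp
  · rw [single_of_notMem σ _ hx, single_of_notMem]
    exact fun h' => hx ((Subgroup.mul_mem_cancel_left H (H.inv_mem h.2)).1 h')

/-- Translates of `single σ v` act as evaluation functionals, so a vector orthogonal to all of them
vanishes. -/
theorem inner_ind_single (g : G) (v : K) (F : IndSpace σ) :
    inner ℂ (ind σ g (single σ v)) F = inner ℂ v (F.toFun g) := by
  rw [inner_eq_tsum, tsum_eq_single (g : G ⧸ H)]
  · have hm : g⁻¹ * (g : G ⧸ H).out ∈ H := QuotientGroup.eq.1 (by simp)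
    rw [ind_apply, single_of_mem σ v hm, inner_rep_left, inv_inv, F.apply_eq g]
  · intro q hq
    rw [ind_apply, single_of_notMem, inner_zero_left]
    intro h
    apply hq
    rw [← QuotientGroup.out_eq' q, eq_comm, QuotientGroup.eq]
    exact h

variable {σ}

/-- The matrix coefficient at `g` of a linear map between induced representation spaces. -/
def coeff (A : IndSpace σ →ₗ[ℂ] IndSpace ρ) (g : G) : K →ₗ[ℂ] K' where
  toFun v := (A (single σ v)).toFun g
  map_add' v w := by rw [map_add, map_add, toFun_add]
  map_smul' c v := by rw [map_smul, map_smul, toFun_smul, RingHom.id_apply]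

theorem coeff_apply (A : IndSpace σ →ₗ[ℂ] IndSpace ρ) (g : G) (v : K) :
    coeff A g v = (A (single σ v)).toFun g := rfl

theorem coeff_mul_right (A : IndSpace σ →ₗ[ℂ] IndSpace ρ) (g : G) (l : L) (v : K) :
    coeff A (g * l) v = ρ l⁻¹ (coeff A g v) := map_mul _ _ _

theorem coeff_mul_left (A : IndSpace σ →ₗ[ℂ] IndSpace ρ)
    (hA : ∀ g F, A (ind σ g F) = ind ρ g (A F)) (h : H) (g : G) (v : K) :
    coeff A (h * g) v = coeff A g (σ h⁻¹ v) := by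
  rw [coeff_apply, coeff_apply, ← ind_single, hA, ind_apply]
  simp

/-- A coefficient vanishes at `g` if the `H`-orbit of `gL` in `G/L` is infinite. -/
theorem coeff_eq_zero [FiniteDimensional ℂ K] (A : IndSpace σ →ₗ[ℂ] IndSpace ρ)
    (hA : ∀ g F, A (ind σ g F) = ind ρ g (A F)) {g : G} {h : ℕ → H}
    (hinj : Function.Injective fun n => ((h n * g : G) : G ⧸ L)) : coeff A g = 0 := by
  ext v
  let b := Module.finBasis ℂ K
  obtain ⟨C, -, hC⟩ := b.exists_opNorm_le (F := K')
  -- Each of the finitely many functions `A (single σ (b i))` is square summable over `G/L`, so its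
  -- values along the distinct cosets of `h n * g` tend to `0`.
  have hlim : Tendsto (fun n => C * (∑ i, ‖coeff A (h n * g) (b i)‖) * ‖v‖) atTop (𝓝 0) := by
    have hsum : Tendsto (fun n => ∑ i, ‖coeff A (h n * g) (b i)‖) atTop 
        (𝓝 (∑ _i : Fin (Module.finrank ℂ K), (0 : ℝ))) := by
      refine tendsto_finsetSum _ fun i _ => ?_
      have hs := (A (single σ (b i))).2.2.comp_injective hinj
      have ht := (hs.tendsto_atTop_zero).sqrt
      simp only [Function.comp_def, Real.sqrt_zero, Real.sqrt_sq (norm_nonneg _)] at ht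
      refine ht.congr fun n => ?_
      exact norm_out (A (single σ (b i))) (h n * g)
    simpa using (hsum.const_mul C).mul_const ‖v‖
  -- The vector `σ (h n) v` varies with `n` but has constant norm, so a bound on the whole operator
  -- is needed; `C` supplies it from the values on the basis.
  have hle : ∀ n, ‖coeff A g v‖ ≤ C * (∑ i, ‖coeff A (h n * g) (b i)‖) * ‖v‖ := by
    intro n
    have h1 : coeff A g v = (coeff A (h n * g)).toContinuousLinearMap (σ (h n) v) := by
      rw [LinearMap.coe_toContinuousLinearMap', coeff_mul_left A hA, rep_inv_apply_apply]
    have h2 : ‖(coeff A (h n * g)).toContinuousLinearMap‖ ≤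
        C * ∑ i, ‖coeff A (h n * g) (b i)‖ :=
      hC (Finset.sum_nonneg fun _ _ => norm_nonneg _) fun i =>
        Finset.single_le_sum (f := fun i => ‖coeff A (h n * g) (b i)‖)
          (fun _ _ => norm_nonneg _) (Finset.mem_univ i)
    rw [h1]
    refine (ContinuousLinearMap.le_opNorm _ _).trans ?_
    rw [LinearIsometryEquiv.norm_map]
    gcongr
  exact norm_le_zero_iff.1 (ge_of_tendsto' hlim hle)

/-- Intertwiners which agree on the elements supported on `H` are equal. -/
theorem intertwiner_ext [CompleteSpace K] {A B : IndSpace σ →L[ℂ] IndSpace ρ}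
    (hA : ∀ g F, A (ind σ g F) = ind ρ g (A F)) (hB : ∀ g F, B (ind σ g F) = ind ρ g (B F))
    (h : ∀ v, A (single σ v) = B (single σ v)) : A = B := by
  let N : Submodule ℂ (IndSpace σ) := LinearMap.ker (A - B).toLinearMap
  have hN : IsClosed (N : Set (IndSpace σ)) := (A - B).isClosed_ker
  have : CompleteSpace N := hN.completeSpace_coe
  have htop : N = ⊤ := by
    rw [← Submodule.orthogonal_eq_bot_iff, Submodule.eq_bot_iff]
    intro F hF
    refine ext_toFun fun x => ext_inner_left ℂ fun v => ?_
    rw [← inner_ind_single]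
    have hmem : ind σ x (single σ v) ∈ N := by
      change (A - B) (ind σ x (single σ v)) = 0
      rw [_root_.sub_apply, hA, hB, h, sub_self]
    rw [(Submodule.mem_orthogonal _ _).1 hF _ hmem]
    exact inner_zero_right v |>.symm
  ext1 F
  have hF : F ∈ N := by rw [htop]; trivial
  exact sub_eq_zero.1 hF

/-- A nonzero intertwiner has a nonzero coefficient. -/
theorem exists_coeff_ne_zero [CompleteSpace K] {A : IndSpace σ →L[ℂ] IndSpace ρ}
    (hA : ∀ g F, A (ind σ g F) = ind ρ g (A F)) (h0 : A ≠ 0) :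
    ∃ g, coeff (A : IndSpace σ →ₗ[ℂ] IndSpace ρ) g ≠ 0 := by
  by_contra! h
  refine h0 (intertwiner_ext hA (fun g F => ?_) fun v => ext_toFun fun x => ?_)
  · simp
  · exact LinearMap.congr_fun (h x) v

end IndSpace

open IndSpace

theorem nontrivial_indSpace [Nontrivial K] : Nontrivial (IndSpace σ) := by
  obtain ⟨v, hv⟩ := exists_ne (0 : K)
  refine ⟨single σ v, 0, fun h => hv ?_⟩
  rw [← single_one σ v, h]
  rfl

/-- Irreducibility of an induced representation when all nontrivial `H`-orbits in `G/H` are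
infinite. -/
theorem isIrreducibleRep_ind [FiniteDimensional ℂ K] (hσ : IsIrreducibleRep σ)
    (hH : ∀ g ∉ H, ∃ h : ℕ → H, Function.Injective fun n => ((h n * g : G) : G ⧸ H)) :
    IsIrreducibleRep (ind σ) := by
  have := hσ.1
  have : CompleteSpace K := FiniteDimensional.complete ℂ K
  refine ⟨nontrivial_indSpace, fun W hW hinv => ?_⟩
  have : CompleteSpace W := hW.completeSpace_coe
  let P : IndSpace σ →L[ℂ] IndSpace σ := W.starProjection
  have hP : ∀ g F, P (ind σ g F) = ind σ g (P F) := by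
    intro g F
    -- The orthogonal complement of `W` is invariant too, by unitarity.
    refine Submodule.eq_starProjection_of_mem_of_inner_eq_zero
      (hinv g _ (Submodule.starProjection_apply_mem W F)) fun w hw => ?_
    rw [← map_sub, inner_rep_left]
    exact Submodule.starProjection_inner_eq_zero F _ (hinv _ w hw)
  -- The coefficient at `1` commutes with `σ`: compare left and right equivariance at the element
  -- `h⁻¹`.
  obtain ⟨c, hc⟩ := hσ.exists_eq_smul (coeff (P : IndSpace σ →ₗ[ℂ] IndSpace σ) 1) fun h v => by
    have h1 := coeff_mul_left (P : IndSpace σ →ₗ[ℂ] IndSpace σ) hP h⁻¹ 1 v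
    have h2 := coeff_mul_right (P : IndSpace σ →ₗ[ℂ] IndSpace σ) 1 h⁻¹ v
    rw [mul_one, inv_inv] at h1
    rw [one_mul, inv_inv] at h2
    rw [← h1, ← h2]
  have hPc : P = c • ContinuousLinearMap.id ℂ (IndSpace σ) := by
    refine intertwiner_ext hP (fun g F => by simp) fun v => ext_toFun fun x => ?_
    change coeff (P : IndSpace σ →ₗ[ℂ] IndSpace σ) x v = c • (single σ v).toFun x
    by_cases hx : x ∈ H
    · have h2 := coeff_mul_right (P : IndSpace σ →ₗ[ℂ] IndSpace σ) 1 ⟨x, hx⟩ v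
      rw [one_mul, hc, map_smul] at h2
      rw [h2, single_of_mem σ v hx]
    · obtain ⟨h, hh⟩ := hH x hx
      rw [coeff_eq_zero _ hP hh, single_of_notMem σ v hx, smul_zero, LinearMap.zero_apply]
  by_cases h1 : c = 1
  · right
    rw [eq_top_iff]
    intro F _
    have : P F = F := by simp [hPc, h1]
    rw [← this]
    exact Submodule.starProjection_apply_mem W F
  · left
    rw [Submodule.eq_bot_iff]
    intro F hF
    have h2 : P F = F := Submodule.starProjection_eq_self_iff.2 hF
    have h3 : P F = c • F := by simp [hPc]
    rw [h3] at h2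
    have h4 : (c - 1) • F = 0 := by rw [sub_smul, h2, one_smul, sub_self]
    exact (smul_eq_zero.1 h4).resolve_left (sub_ne_zero.2 h1)

/-! ### Conjugate subgroups and equivalence of induced representations -/

theorem inv_mul_mem_iff_of_eq_conj {g : G}
    (hL : L = H.map (MulAut.conj (g⁻¹)⁻¹).toMonoidHom) (l : G) : l ∈ L ↔ g⁻¹ * l * g ∈ H := by
  rw [hL]
  constructor
  · rintro ⟨h, hh, rfl⟩
    simpa [mul_assoc] using hh
  · intro h
    exact ⟨_, h, by simp [mul_assoc]⟩

/-- The bijection `G/gHg⁻¹ → G/H`, `xgHg⁻¹ ↦ xgH`. -/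
def cosetEquiv (g : G) (hL : L = H.map (MulAut.conj (g⁻¹)⁻¹).toMonoidHom) : G ⧸ L ≃ G ⧸ H :=
  Quotient.congr (Equiv.mulRight g) fun a b => by
    rw [QuotientGroup.leftRel_apply, QuotientGroup.leftRel_apply, inv_mul_mem_iff_of_eq_conj hL]
    simp [mul_assoc]

theorem cosetEquiv_mk (g : G) (hL : L = H.map (MulAut.conj (g⁻¹)⁻¹).toMonoidHom) (a : G) :
    cosetEquiv g hL (a : G ⧸ L) = ((a * g : G) : G ⧸ H) := rfl

theorem cosetEquiv_symm_mk (g : G) (hL : L = H.map (MulAut.conj (g⁻¹)⁻¹).toMonoidHom) (a : G) :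
    (cosetEquiv g hL).symm (a : G ⧸ H) = ((a * g⁻¹ : G) : G ⧸ L) := rfl

theorem norm_out_cosetEquiv (g : G) (hL : L = H.map (MulAut.conj (g⁻¹)⁻¹).toMonoidHom)
    (F : IndSpace σ) (q : G ⧸ L) :
    ‖F.toFun (cosetEquiv g hL q).out‖ = ‖F.toFun (q.out * g)‖ := by
  conv_lhs => rw [← QuotientGroup.out_eq' q]
  rw [cosetEquiv_mk, norm_out]

theorem norm_out_cosetEquiv_symm (g : G) (hL : L = H.map (MulAut.conj (g⁻¹)⁻¹).toMonoidHom)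
    (F : IndSpace ρ) (q : G ⧸ H) :
    ‖F.toFun ((cosetEquiv g hL).symm q).out‖ = ‖F.toFun (q.out * g⁻¹)‖ := by
  conv_lhs => rw [← QuotientGroup.out_eq' q]
  rw [cosetEquiv_symm_mk, norm_out]

/-- Inducing a conjugate representation gives an equivalent representation. -/
theorem unitarilyEquivalent_ind_of_conjRep (g : G)
    (hL : L = H.map (MulAut.conj (g⁻¹)⁻¹).toMonoidHom)
    (h : UnitarilyEquivalent ρ (conjRep g⁻¹ hL σ)) :
    UnitarilyEquivalent (ind σ) (ind ρ) := by
  obtain ⟨U, hU⟩ := h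
  have hmem : ∀ l : L, g⁻¹ * l * g⁻¹⁻¹ ∈ H := by
    intro l
    rw [inv_inv]
    exact (inv_mul_mem_iff_of_eq_conj hL l).1 l.2
  have hUσ : ∀ (l : L) v, U (ρ l v) = σ ⟨g⁻¹ * l * g⁻¹⁻¹, hmem l⟩ (U v) := fun l v => by
    rw [hU, conjRep_apply g⁻¹ hL σ l (hmem l)]
  -- Right translation by `g` turns equivariance under `H` into equivariance under `L = gHg⁻¹`;
  -- `U.symm` then matches the values with `ρ`.
  let Φ : IndSpace σ →ₗᵢ[ℂ] IndSpace ρ :=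
    { toFun := fun F => ⟨fun x => U.symm (F.toFun (x * g)), fun x l => by
          apply U.injective
          rw [hUσ, U.apply_symm_apply, U.apply_symm_apply]
          have e : x * l * g = x * g * (⟨g⁻¹ * l * g⁻¹⁻¹, hmem l⟩ : H) := by
            simp [mul_assoc]
          rw [e, F.map_mul]
          congr 2
          ext
          simp [mul_assoc], by
          refine (((cosetEquiv g hL).summable_iff).2 F.2.2).congr fun q => ?_
          rw [LinearIsometryEquiv.norm_map, ← norm_out_cosetEquiv g hL]
          rfl⟩
      map_add' := fun F₁ F₂ => ext_toFun fun x => map_add U.symm _ _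
      map_smul' := fun c F => ext_toFun fun x => map_smul U.symm _ _
      norm_map' := fun F => by
        rw [← sq_eq_sq₀ (norm_nonneg _) (norm_nonneg _), norm_sq_eq_tsum, norm_sq_eq_tsum,
          ← (cosetEquiv g hL).tsum_eq]
        refine tsum_congr fun q => ?_
        rw [norm_out_cosetEquiv]
        exact congrArg (· ^ 2) (U.symm.norm_map _) }
  have hΦ : ∀ F x, (Φ F).toFun x = U.symm (F.toFun (x * g)) := fun _ _ => rfl
  have hΦsurj : Function.Surjective Φ := fun F => by
    refine ⟨⟨fun x => U (F.toFun (x * g⁻¹)), fun x k => ?_, ?_⟩, ext_toFun fun x => ?_⟩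
    · have hk : g * k * g⁻¹ ∈ L := by
        rw [inv_mul_mem_iff_of_eq_conj hL]
        simp [mul_assoc]
      have e : x * k * g⁻¹ = x * g⁻¹ * (⟨_, hk⟩ : L) := by simp [mul_assoc]
      beta_reduce
      rw [e, F.map_mul, hUσ]
      congr 2
      ext
      simp [mul_assoc]
    · refine (((cosetEquiv g hL).symm.summable_iff).2 F.2.2).congr fun q => ?_
      rw [LinearIsometryEquiv.norm_map, ← norm_out_cosetEquiv_symm g hL]
      rfl
    · change U.symm (U (F.toFun (x * g * g⁻¹))) = _
      rw [U.symm_apply_apply, mul_inv_cancel_right]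
  refine ⟨LinearIsometryEquiv.ofSurjective Φ hΦsurj, fun a F => ext_toFun fun x => ?_⟩
  rw [LinearIsometryEquiv.coe_ofSurjective, hΦ, ind_apply, ind_apply, hΦ, mul_assoc]

end Intertwiners

/-! ### Elements of Thompson's group -/

theorem periodic_coe_of_lift {f : ℝ ≃o ℝ} (hf : ∀ t, f (t + 1) = f t + 1) :
    Function.Periodic (fun t => ((f t : ℝ) : UnitAddCircle)) 1 := fun t => by
  simp only [hf, AddCircle.coe_add]
  rw [AddCircle.coe_period, add_zero]

/-- The homeomorphism of the circle with lift `f`. -/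
def circleHomeo (f : ℝ ≃o ℝ) (hf : ∀ t, f (t + 1) = f t + 1)
    (hf' : ∀ t, f.symm (t + 1) = f.symm t + 1) : UnitAddCircle ≃ₜ UnitAddCircle where
  toFun := (periodic_coe_of_lift hf).lift
  invFun := (periodic_coe_of_lift hf').lift
  left_inv z := by
    obtain ⟨t, rfl⟩ := QuotientAddGroup.mk_surjective z
    rw [Function.Periodic.lift_coe, Function.Periodic.lift_coe, OrderIso.symm_apply_apply]
  right_inv z := by
    obtain ⟨t, rfl⟩ := QuotientAddGroup.mk_surjective z
    rw [Function.Periodic.lift_coe, Function.Periodic.lift_coe, OrderIso.apply_symm_apply]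
  continuous_toFun := continuous_quot_lift _
    ((AddCircle.continuous_mk' 1).comp f.continuous)
  continuous_invFun := continuous_quot_lift _
    ((AddCircle.continuous_mk' 1).comp f.symm.continuous)

theorem exists_thompsonT_of_lift (f : ℝ ≃o ℝ) (hf : ∀ t, f (t + 1) = f t + 1)
    {B : Set UnitAddCircle} (hB : B.Finite) (hBd : B ⊆ dyadicPoints)
    (ha : ∀ t : ℝ, (t : UnitAddCircle) ∉ B → AffineNear f t)
    (hd : ∀ t : ℝ, (∃ (m : ℤ) (n : ℕ), t = m / 2 ^ n) → ∃ (m : ℤ) (n : ℕ), f t = m / 2 ^ n) :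
    ∃ g : thompsonT, ∀ t : ℝ, g • (t : UnitAddCircle) = (f t : ℝ) := by
  have hf' : ∀ t, f.symm (t + 1) = f.symm t + 1 := fun t => by
    apply f.injective
    rw [hf, OrderIso.apply_symm_apply, OrderIso.apply_symm_apply]
  have hg : ∀ t : ℝ, circleHomeo f hf hf' (t : UnitAddCircle) = (f t : ℝ) := fun _ => rfl
  refine ⟨⟨circleHomeo f hf hf', ⟨f, hf, fun t => (hg t).symm, B, hB, hBd, ha⟩, fun z hz => ?_⟩, hg⟩
  obtain ⟨t, rfl⟩ := QuotientAddGroup.mk_surjective z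
  exact mem_dyadicPoints_iff.2 (hd t (mem_dyadicPoints_iff.1 hz))

/-! ### Dyadic rotations and density of orbits -/

theorem dyadic_intCast (m : ℤ) : ∃ (m' : ℤ) (n : ℕ), (m : ℝ) = m' / 2 ^ n := ⟨m, 0, by simp⟩

theorem dyadic_add {s t : ℝ} (hs : ∃ (m : ℤ) (n : ℕ), s = m / 2 ^ n)
    (ht : ∃ (m : ℤ) (n : ℕ), t = m / 2 ^ n) : ∃ (m : ℤ) (n : ℕ), s + t = m / 2 ^ n := by
  have h := dyadic_sub hs (dyadic_sub (dyadic_intCast 0) ht)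
  rwa [Int.cast_zero, zero_sub, sub_neg_eq_add] at h

theorem exists_dyadic_rotation {d : ℝ} (hd : ∃ (m : ℤ) (n : ℕ), d = m / 2 ^ n) :
    ∃ g : thompsonT, ∀ t : ℝ, g • (t : UnitAddCircle) = (t + d : ℝ) :=
  exists_thompsonT_of_lift (OrderIso.addRight d) (fun t => by simp; ring) Set.finite_empty
    (Set.empty_subset _) (fun _ _ => ⟨0, d, by simp⟩) fun _ ht => dyadic_add ht hd

theorem exists_dyadic_mem_Ioo {a b : ℝ} (h : a < b) :
    ∃ s ∈ Set.Ioo a b, ∃ (m : ℤ) (n : ℕ), s = m / 2 ^ n := by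
  have hm : ∀ᶠ s in 𝓝 ((a + b) / 2), s ∈ Set.Ioo a b :=
    Ioo_mem_nhds (by linarith) (by linarith)
  exact exists_dyadic_near hm

theorem dense_orbit (x : UnitAddCircle) : Dense (MulAction.orbit thompsonT x) := by
  obtain ⟨s, rfl⟩ := QuotientAddGroup.mk_surjective x
  intro z
  obtain ⟨t, rfl⟩ := QuotientAddGroup.mk_surjective z
  rw [mem_closure_iff_nhds]
  intro U hU
  have hU' : ∀ᶠ d in 𝓝 (t - s), ((s + d : ℝ) : UnitAddCircle) ∈ U := by
    have hc : ContinuousAt (fun d : ℝ => ((s + d : ℝ) : UnitAddCircle)) (t - s) :=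
      ((AddCircle.continuous_mk' 1).comp (continuous_const.add continuous_id)).continuousAt
    refine hc.eventually_mem ?_
    rwa [add_sub_cancel]
  obtain ⟨d, hdU, hd⟩ := exists_dyadic_near hU'
  obtain ⟨g, hg⟩ := exists_dyadic_rotation hd
  exact ⟨_, hdU, g, hg s⟩

/-! ### An element of `T` pushing the points of a dyadic interval to the left -/

/-- The displacement `s - φ(s)` of the piecewise linear homeomorphism `φ` of `[0,1]` with slopes
`1/2`, `1`, `2` on `[0,1/2]`, `[1/2,3/4]`, `[3/4,1]`, extended by zero. -/
def bump (s : ℝ) : ℝ := max 0 (min (min (s / 2) (1 / 4)) (1 - s))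

theorem continuous_bump : Continuous bump := by
  unfold bump
  fun_prop

theorem bump_nonneg (s : ℝ) : 0 ≤ bump s := le_max_left _ _

theorem bump_le {s : ℝ} (hs : 0 ≤ s) : bump s ≤ s / 2 :=
  max_le (by linarith) ((min_le_left _ _).trans (min_le_left _ _))

theorem bump_pos {s : ℝ} (h0 : 0 < s) (h1 : s < 1) : 0 < bump s :=
  lt_max_of_lt_right (lt_min (lt_min (by linarith) (by norm_num)) (by linarith))

theorem bump_of_one_le {s : ℝ} (h : 1 ≤ s) : bump s = 0 :=
  max_eq_left ((min_le_right _ _).trans (by linarith))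

theorem bump_zero : bump 0 = 0 := by norm_num [bump]

/-- The slopes of `bump` are at most `1/2`, so `s - bump s` increases with slope at least `1/2`. -/
theorem bump_sub_le {s t : ℝ} (h : s ≤ t) : bump t - bump s ≤ (t - s) / 2 := by
  unfold bump
  rw [sub_le_iff_le_add]
  refine max_le (by linarith [le_max_left 0 (min (min (s / 2) (1 / 4)) (1 - s))]) ?_
  have h1 := le_max_right 0 (min (min (s / 2) (1 / 4)) (1 - s))
  suffices min (min (t / 2) (1 / 4)) (1 - t) ≤ (t - s) / 2 + min (min (s / 2) (1 / 4)) (1 - s) by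
    linarith
  rw [← sub_le_iff_le_add']
  refine le_min (le_min ?_ ?_) ?_
  · linarith [min_le_left (min (t / 2) (1 / 4)) (1 - t), min_le_left (t / 2) (1 / 4)]
  · linarith [min_le_left (min (t / 2) (1 / 4)) (1 - t), min_le_right (t / 2) (1 / 4)]
  · linarith [min_le_right (min (t / 2) (1 / 4)) (1 - t)]

theorem dyadic_bump {s : ℝ} (hs : ∃ (m : ℤ) (n : ℕ), s = m / 2 ^ n) :
    ∃ (m : ℤ) (n : ℕ), bump s = m / 2 ^ n := by
  have h0 := dyadic_intCast 0
  have h1 := dyadic_sub (dyadic_intCast 1) hs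
  have h2 := dyadic_zpow_mul hs (-1)
  have h4 : ∃ (m : ℤ) (n : ℕ), (1 / 4 : ℝ) = m / 2 ^ n := ⟨1, 2, by norm_num⟩
  rw [Int.cast_zero] at h0
  rw [Int.cast_one] at h1
  have e : (2 : ℝ) ^ (-1 : ℤ) * s = s / 2 := by
    rw [zpow_neg_one]
    ring
  rw [e] at h2
  unfold bump
  rcases max_choice 0 (min (min (s / 2) (1 / 4)) (1 - s)) with h | h <;> rw [h]
  · exact h0
  rcases min_choice (min (s / 2) (1 / 4)) (1 - s) with h | h <;> rw [h]
  · rcases min_choice (s / 2) (1 / 4) with h | h <;> rw [h]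
    exacts [h2, h4]
  · exact h1

theorem affineNear_sub_bump {s : ℝ} (hs : 0 < s) (h2 : s ≠ 1 / 2) (h3 : s ≠ 3 / 4) (h1 : s ≠ 1) :
    AffineNear (fun t => t - bump t) s := by
  rcases lt_or_gt_of_ne h2 with h | h
  · refine ⟨-1, 0, ?_⟩
    filter_upwards [Ioo_mem_nhds hs h] with t ht
    rw [bump, min_eq_left (by linarith [ht.1, ht.2] : t / 2 ≤ 1 / 4),
      min_eq_left (by linarith [ht.1, ht.2]), max_eq_right (by linarith [ht.1]), zpow_neg_one]
    ring
  rcases lt_or_gt_of_ne h3 with h' | h'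
  · refine ⟨0, -(1 / 4), ?_⟩
    filter_upwards [Ioo_mem_nhds h h'] with t ht
    rw [bump, min_eq_right (by linarith [ht.1, ht.2] : 1 / 4 ≤ t / 2),
      min_eq_left (by linarith [ht.1, ht.2]), max_eq_right (by norm_num), zpow_zero]
    ring
  rcases lt_or_gt_of_ne h1 with h'' | h''
  · refine ⟨1, -1, ?_⟩
    filter_upwards [Ioo_mem_nhds h' h''] with t ht
    rw [bump, min_eq_right (by linarith [ht.1, ht.2] : 1 / 4 ≤ t / 2),
      min_eq_right (by linarith [ht.1, ht.2]), max_eq_right (by linarith [ht.2]), zpow_one]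
    ring
  · refine ⟨0, 0, ?_⟩
    filter_upwards [Ioi_mem_nhds h''] with t ht
    rw [bump_of_one_le (le_of_lt ht), zpow_zero]
    ring

/-- The lift of the element of `T` acting as a scaled copy of `s ↦ s - bump s` on
`[a, a + 2⁻ⁿ]` and trivially elsewhere. -/
def pushFun (a : ℝ) (n : ℕ) (t : ℝ) : ℝ := t - bump (Int.fract (t - a) * 2 ^ n) / 2 ^ n

theorem pushFun_add_one (a : ℝ) (n : ℕ) (t : ℝ) : pushFun a n (t + 1) = pushFun a n t + 1 := by
  have h : t + 1 - a = t - a + 1 := by ring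
  rw [pushFun, pushFun, h, Int.fract_add_one]
  ring

theorem pushFun_le (a : ℝ) (n : ℕ) (t : ℝ) : pushFun a n t ≤ t := by
  have := bump_nonneg (Int.fract (t - a) * 2 ^ n)
  rw [pushFun, sub_le_self_iff]
  positivity

/-- Since `bump s ≤ s / 2`, no point is pushed to the left past a translate of `a` by an integer. -/
theorem floor_le_pushFun_sub (a : ℝ) (n : ℕ) (t : ℝ) : (⌊t - a⌋ : ℝ) ≤ pushFun a n t - a := by
  have h0 := Int.fract_nonneg (t - a)
  have h1 := Int.floor_add_fract (t - a)
  have h2 : bump (Int.fract (t - a) * 2 ^ n) / 2 ^ n ≤ Int.fract (t - a) / 2 := by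
    rw [div_le_iff₀ (by positivity)]
    refine (bump_le (by positivity)).trans (le_of_eq (by ring))
  rw [pushFun]
  linarith

theorem strictMono_pushFun (a : ℝ) (n : ℕ) : StrictMono (pushFun a n) := by
  intro s t hst
  -- Within one period the slope bound applies; otherwise a translate of `a` separates the two
  -- images.
  rcases (Int.floor_le_floor (sub_le_sub_right hst.le a)).eq_or_lt with h | h
  · have hs := Int.floor_add_fract (s - a)
    have ht := Int.floor_add_fract (t - a)
    rw [← h] at ht
    have hp : (0 : ℝ) < 2 ^ n := by positivity
    have h1 := bump_sub_le (mul_le_mul_of_nonneg_right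
      (by linarith : Int.fract (s - a) ≤ Int.fract (t - a)) hp.le)
    have h2 : bump (Int.fract (t - a) * 2 ^ n) / 2 ^ n - bump (Int.fract (s - a) * 2 ^ n) / 2 ^ n ≤
        (Int.fract (t - a) - Int.fract (s - a)) / 2 := by
      rw [← sub_div, div_le_iff₀ hp]
      linarith
    rw [pushFun, pushFun]
    linarith
  · have h1 := floor_le_pushFun_sub a n t
    have h2 := pushFun_le a n s
    have h3 := Int.lt_floor_add_one (s - a)
    have h4 : ((⌊s - a⌋ + 1 : ℤ) : ℝ) ≤ ⌊t - a⌋ := Int.cast_le.2 h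
    push_cast at h4
    linarith

theorem continuous_pushFun (a : ℝ) (n : ℕ) : Continuous (pushFun a n) := by
  have h : Continuous ((fun s : ℝ => bump (s * 2 ^ n) / 2 ^ n) ∘ Int.fract) := by
    -- A continuous function composed with `Int.fract` is continuous if its values at `0` and `1`
    -- agree; here both are `0`, because `2 ^ n ≥ 1`.
    refine ContinuousOn.comp_fract'' (Continuous.continuousOn ?_) ?_
    · exact (continuous_bump.comp (by fun_prop)).div_const _
    · rw [zero_mul, bump_zero, bump_of_one_le]
      rw [one_mul]
      exact one_le_pow₀ one_le_two
  exact continuous_id.sub (h.comp (continuous_id.sub continuous_const))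

theorem surjective_pushFun (a : ℝ) (n : ℕ) : Function.Surjective (pushFun a n) := by
  refine (continuous_pushFun a n).surjective ?_ ?_
  · refine tendsto_atTop_mono (fun t => ?_) (tendsto_atTop_add_const_right _ (-1) tendsto_id)
    have h1 := floor_le_pushFun_sub a n t
    have h2 := Int.lt_floor_add_one (t - a)
    simp only [id]
    linarith
  · exact tendsto_atBot_mono (pushFun_le a n) tendsto_id

theorem pushFun_lt {a : ℝ} {n : ℕ} {t : ℝ} (h : t ∈ Set.Ioo a (a + 1 / 2 ^ n)) :
    pushFun a n t < t := by
  have hp : (0 : ℝ) < 2 ^ n := by positivity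
  have h1 : (1 : ℝ) / 2 ^ n ≤ 1 := by
    rw [div_le_one hp]
    exact one_le_pow₀ one_le_two
  have hfr : Int.fract (t - a) = t - a :=
    Int.fract_eq_self.2 ⟨by linarith [h.1], by linarith [h.2]⟩
  have h2 : 0 < bump (Int.fract (t - a) * 2 ^ n) := by
    rw [hfr]
    refine bump_pos (mul_pos (by linarith [h.1]) hp) ?_
    rw [← lt_div_iff₀ hp]
    linarith [h.2]
  rw [pushFun, sub_lt_self_iff]
  positivity

theorem pushFun_self (a : ℝ) (n : ℕ) : pushFun a n a = a := by
  simp [pushFun, bump_zero]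

theorem pushFun_of_mem_Ico {a : ℝ} {n : ℕ} {t : ℝ} (h : t ∈ Set.Ico (a + 1 / 2 ^ n) (a + 1)) :
    pushFun a n t = t := by
  have hp : (0 : ℝ) < 2 ^ n := by positivity
  have h0 : (0 : ℝ) < 1 / 2 ^ n := by positivity
  have hfr : Int.fract (t - a) = t - a :=
    Int.fract_eq_self.2 ⟨by linarith [h.1], by linarith [h.2]⟩
  rw [pushFun, hfr, bump_of_one_le, zero_div, sub_zero]
  rw [← div_le_iff₀ hp]
  linarith [h.1]

theorem affineNear_pushFun {a : ℝ} {n : ℕ} {t : ℝ}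
    (h : ∀ p ∈ ({0, 1 / 2, 3 / 4, 1} : Set ℝ), Int.fract (t - a) * 2 ^ n ≠ p) :
    AffineNear (pushFun a n) t := by
  have hp : (0 : ℝ) < 2 ^ n := by positivity
  have h0 : 0 < Int.fract (t - a) :=
    lt_of_le_of_ne (Int.fract_nonneg _) fun h' => h 0 (by simp) (by rw [← h', zero_mul])
  obtain ⟨k, c, hk⟩ := affineNear_sub_bump (mul_pos h0 hp) (h _ (by simp)) (h _ (by simp))
    (h _ (by simp))
  set m : ℤ := ⌊t - a⌋ with hm
  have hfl := Int.floor_add_fract (t - a)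
  rw [← hm] at hfl
  have hc : ContinuousAt (fun s : ℝ => (s - a - m) * 2 ^ n) t := by fun_prop
  have hmt : Int.fract (t - a) * 2 ^ n = (t - a - m) * 2 ^ n := rfl
  rw [hmt] at hk
  -- Conjugation by `s ↦ (s - a - m) * 2 ^ n` preserves the slope; the second entry is the resulting
  -- constant term.
  refine ⟨k, (a + m) + (2 ^ k * (-(a + m) * 2 ^ n) + c) / 2 ^ n, ?_⟩
  have hnear : Set.Ioo (a + m) (a + m + 1) ∈ 𝓝 t :=
    Ioo_mem_nhds (by linarith) (by linarith [Int.fract_lt_one (t - a)])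
  filter_upwards [hc.eventually hk, hnear] with s hs hs'
  have hfs : Int.fract (s - a) = s - a - m := by
    rw [Int.fract_eq_iff]
    exact ⟨by linarith [hs'.1], by linarith [hs'.2], m, by ring⟩
  rw [pushFun, hfs]
  have e : bump ((s - a - m) * 2 ^ n) =
      (s - a - m) * 2 ^ n - (2 ^ k * ((s - a - m) * 2 ^ n) + c) := by linarith
  rw [e]
  field_simp
  ring

theorem dyadic_pushFun {a t : ℝ} (n : ℕ) (ha : ∃ (m : ℤ) (n : ℕ), a = m / 2 ^ n)
    (ht : ∃ (m : ℤ) (n : ℕ), t = m / 2 ^ n) :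
    ∃ (m : ℤ) (n' : ℕ), pushFun a n t = m / 2 ^ n' := by
  have h1 := dyadic_sub (dyadic_sub ht ha) (dyadic_intCast ⌊t - a⌋)
  have h2 := dyadic_zpow_mul (dyadic_bump (dyadic_zpow_mul h1 n)) (-n)
  have h3 := dyadic_sub ht h2
  have e : pushFun a n t = t - 2 ^ (-n : ℤ) * bump (2 ^ (n : ℤ) * (t - a - ⌊t - a⌋)) := by
    rw [pushFun, Int.fract, zpow_neg, zpow_natCast, mul_comm ((2 : ℝ) ^ n), div_eq_inv_mul]
  rwa [e]

theorem exists_thompsonT_pushFun {a : ℝ} (ha : ∃ (m : ℤ) (n : ℕ), a = m / 2 ^ n) (n : ℕ) :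
    ∃ g : thompsonT, ∀ t : ℝ, g • (t : UnitAddCircle) = (pushFun a n t : ℝ) := by
  let f : ℝ ≃o ℝ := StrictMono.orderIsoOfSurjective (pushFun a n) (strictMono_pushFun a n)
    (surjective_pushFun a n)
  have hf : ⇑f = pushFun a n := StrictMono.coe_orderIsoOfSurjective _ _ _
  have hfin : ({0, 1 / 2, 3 / 4, 1} : Set ℝ).Finite := Set.toFinite _
  obtain ⟨g, hg⟩ := exists_thompsonT_of_lift f (fun t => by rw [hf, pushFun_add_one])
    (B := (fun p : ℝ => ((a + p / 2 ^ n : ℝ) : UnitAddCircle)) '' {0, 1 / 2, 3 / 4, 1})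
    (hfin.image _) (by
      rintro _ ⟨p, hp, rfl⟩
      have hpd : ∃ (m : ℤ) (n : ℕ), p = m / 2 ^ n := by
        rcases hp with rfl | rfl | rfl | rfl
        exacts [⟨0, 0, by norm_num⟩, ⟨1, 1, by norm_num⟩, ⟨3, 2, by norm_num⟩, ⟨1, 0, by norm_num⟩]
      have h := dyadic_add ha (dyadic_zpow_mul hpd (-n))
      rw [zpow_neg, zpow_natCast, ← div_eq_inv_mul] at h
      exact mem_dyadicPoints_iff.2 h)
    (fun t ht => by
      rw [hf]
      refine affineNear_pushFun fun p hp e => ht ⟨p, hp, ?_⟩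
      have e' : t = a + p / 2 ^ n + ⌊t - a⌋ := by
        rw [← e, mul_div_cancel_right₀ _ (by positivity)]
        linarith [Int.floor_add_fract (t - a)]
      conv_rhs => rw [e', AddCircle.coe_add]
      rw [(AddCircle.coe_eq_zero_iff (1 : ℝ) (x := (⌊t - a⌋ : ℝ))).2 ⟨⌊t - a⌋, by simp⟩, add_zero])
    (fun t ht => by
      rw [hf]
      exact dyadic_pushFun n ha ht)
  exact ⟨g, fun t => by rw [hg, hf]⟩

/-- The orbits of the stabilizer of `x` on the complement of `x` are infinite. -/
theorem exists_injective_stabilizer_smul {x z : UnitAddCircle} (hz : z ≠ x) :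
    ∃ h : ℕ → MulAction.stabilizer thompsonT x,
      Function.Injective fun n => (h n : thompsonT) • z := by
  obtain ⟨t, rfl⟩ := QuotientAddGroup.mk_surjective z
  obtain ⟨s, hs, rfl⟩ : ∃ s ∈ Set.Ico t (t + 1), (s : UnitAddCircle) = x :=
    ⟨AddCircle.equivIco 1 t x, (AddCircle.equivIco 1 t x).2, AddCircle.coe_equivIco⟩
  have hts : t < s := lt_of_le_of_ne hs.1 fun h => hz (by rw [← h])
  -- This scale keeps a dyadic interval `[a, a + 2⁻ⁿ]` with `t` in its interior away from `s` and
  -- from `s - 1`, so the push fixes `x`.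
  obtain ⟨n, hn⟩ := exists_pow_lt_of_lt_one (lt_min (sub_pos.2 hts) (sub_pos.2 hs.2))
    (by norm_num : (1 / 2 : ℝ) < 1)
  rw [one_div_pow] at hn
  have hn1 := hn.trans_le (min_le_left _ _)
  have hn2 := hn.trans_le (min_le_right _ _)
  have hpos : (0 : ℝ) < 1 / 2 ^ n := by positivity
  obtain ⟨a, ⟨ha1, ha2⟩, ha⟩ := exists_dyadic_mem_Ioo (sub_lt_self t hpos)
  obtain ⟨g, hg⟩ := exists_thompsonT_pushFun ha n
  have hgs : g ∈ MulAction.stabilizer thompsonT (s : UnitAddCircle) := by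
    rw [MulAction.mem_stabilizer_iff, hg, pushFun_of_mem_Ico ⟨by linarith, by linarith⟩]
  have hmem : ∀ k, (pushFun a n)^[k] t ∈ Set.Ioo a (a + 1 / 2 ^ n) := by
    intro k
    induction k with
    | zero => exact ⟨ha2, by rw [Function.iterate_zero_apply]; linarith⟩
    | succ k ih =>
      rw [Function.iterate_succ_apply']
      refine ⟨?_, (pushFun_le a n _).trans_lt ih.2⟩
      conv_lhs => rw [← pushFun_self a n]
      exact strictMono_pushFun a n ih.1
  -- The powers of `g` move `t` strictly to the left forever, inside an interval that embeds in the
  -- circle.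
  have hanti : StrictAnti fun k => (pushFun a n)^[k] t := strictAnti_nat_of_succ_lt fun k => by
    rw [Function.iterate_succ_apply']
    exact pushFun_lt (hmem k)
  have hpow : ∀ k : ℕ, g ^ k • (t : UnitAddCircle) = ((pushFun a n)^[k] t : ℝ) := by
    intro k
    induction k with
    | zero => simp
    | succ k ih => rw [pow_succ', mul_smul, ih, hg, Function.iterate_succ_apply']
  refine ⟨fun k => ⟨g ^ k, pow_mem hgs k⟩, fun k l hkl => hanti.injective ?_⟩
  have hkl' : ((pushFun a n)^[k] t : UnitAddCircle) = ((pushFun a n)^[l] t : ℝ) := by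
    rw [← hpow, ← hpow]
    exact hkl
  have hIco : ∀ j, (pushFun a n)^[j] t ∈ Set.Ico a (a + 1) := fun j =>
    ⟨(hmem j).1.le, by linarith [(hmem j).2]⟩
  exact (AddCircle.coe_eq_coe_iff_of_mem_Ico (hIco k) (hIco l)).1 hkl'

/-! ### Stabilizers of irrational points -/

/-- The constant is rational because it can be computed at a nearby dyadic point, whose image is
dyadic. -/
theorem exists_eventually_smul_eq (g : thompsonT) {t : ℝ}
    (ht : (t : UnitAddCircle) ∉ dyadicPoints) :
    ∃ (k : ℤ) (c : ℚ), ∀ᶠ s in 𝓝 t,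
      g • ((s : ℝ) : UnitAddCircle) = (((2 : ℝ) ^ k * s + c : ℝ) : UnitAddCircle) := by
  obtain ⟨g, ⟨f, -, hfg, B, -, hBd, hB⟩, hd⟩ := g
  obtain ⟨k, c, hk⟩ := hB t fun h => ht (hBd h)
  obtain ⟨s, hs, hsd⟩ := exists_dyadic_near hk
  have hfs : ∃ (m : ℤ) (n : ℕ), f s = m / 2 ^ n := by
    rw [← mem_dyadicPoints_iff, hfg]
    exact hd _ (mem_dyadicPoints_iff.2 hsd)
  obtain ⟨m, n, hc⟩ := dyadic_sub hfs (dyadic_zpow_mul hsd k)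
  refine ⟨k, m / 2 ^ n, ?_⟩
  filter_upwards [hk] with r hr
  rw [smul_def, ← hfg, hr]
  have e : c = m / 2 ^ n := by rw [← hc, hs]; ring
  rw [e]
  push_cast
  rfl

theorem dyadicPoints_subset_rationalPoints : dyadicPoints ⊆ rationalPoints := by
  rintro _ ⟨m, n, rfl⟩
  exact ⟨m / 2 ^ n, by push_cast; rfl⟩

theorem mem_rationalPoints_of_affine_eq {t : ℝ} {k : ℤ} {c q : ℚ}
    (h : (2 : ℝ) ^ k * t + c = q) : (t : UnitAddCircle) ∈ rationalPoints := by
  refine ⟨(q - c) / 2 ^ k, congrArg _ ?_⟩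
  have h2 : (2 : ℝ) ^ k ≠ 0 := zpow_ne_zero _ two_ne_zero
  push_cast
  rw [eq_div_iff h2]
  linarith

theorem smul_notMem_rationalPoints (g : thompsonT) {z : UnitAddCircle} (hz : z ∉ rationalPoints) :
    g • z ∉ rationalPoints := by
  obtain ⟨t, rfl⟩ := QuotientAddGroup.mk_surjective z
  obtain ⟨k, c, hk⟩ := exists_eventually_smul_eq g fun h => hz (dyadicPoints_subset_rationalPoints h)
  have hkt := hk.self_of_nhds
  rintro ⟨q, hq⟩
  have h := hkt.symm.trans hq
  rw [← sub_eq_zero, ← AddCircle.coe_sub, AddCircle.coe_eq_zero_iff] at h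
  obtain ⟨m, hm⟩ := h
  rw [zsmul_eq_mul, mul_one] at hm
  exact hz (mem_rationalPoints_of_affine_eq (k := k) (c := c) (q := q + m) (by push_cast; linarith))

/-- An element of `T` fixing an irrational point is trivial in a neighbourhood. -/
theorem eventually_smul_eq_self {g : thompsonT} {z : UnitAddCircle} (hz : z ∉ rationalPoints)
    (hg : g • z = z) : ∀ᶠ w in 𝓝 z, g • w = w := by
  obtain ⟨t, rfl⟩ := QuotientAddGroup.mk_surjective z
  obtain ⟨k, c, hk⟩ := exists_eventually_smul_eq g fun h => hz (dyadicPoints_subset_rationalPoints h)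
  have h := hk.self_of_nhds.symm.trans hg
  have h' : (((2 : ℝ) ^ k * t + c - t : ℝ) : UnitAddCircle) = 0 := by
    rw [AddCircle.coe_sub]
    exact sub_eq_zero.2 h
  obtain ⟨m, hm⟩ := (AddCircle.coe_eq_zero_iff _).1 h'
  rw [zsmul_eq_mul, mul_one] at hm
  -- If the slope were not `1`, the fixed point equation `2 ^ k * t + c = t + m` would have a
  -- rational solution `t`.
  have hk1 : (2 : ℝ) ^ k = 1 := by
    by_contra hne
    refine hz ⟨(m - c) / (2 ^ k - 1), congrArg _ ?_⟩
    push_cast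
    rw [eq_div_iff (sub_ne_zero.2 hne)]
    linarith
  have hcm : (c : ℝ) = m := by rw [hk1] at hm; linarith
  have hmap : 𝓝 (t : UnitAddCircle) ≤ Filter.map ((↑) : ℝ → UnitAddCircle) (𝓝 t) :=
    QuotientAddGroup.isOpenMap_coe.nhds_le t
  refine hmap (Filter.mem_map.2 ?_)
  filter_upwards [hk] with s hs
  change g • (s : UnitAddCircle) = s
  rw [hs, hk1, one_mul, hcm, AddCircle.coe_add,
    (AddCircle.coe_eq_zero_iff (1 : ℝ) (x := (m : ℝ))).2 ⟨m, by simp⟩, add_zero]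

theorem conjClass_stabilizer_eq (x : UnitAddCircle) :
    conjClass (MulAction.stabilizer thompsonT x) =
      MulAction.stabilizer thompsonT '' MulAction.orbit thompsonT x := by
  ext S
  constructor
  · rintro ⟨g, rfl⟩
    exact ⟨g • x, ⟨g, rfl⟩, MulAction.stabilizer_smul_eq_stabilizer_map_conj g x⟩
  · rintro ⟨_, ⟨g, rfl⟩, rfl⟩
    exact ⟨g, (MulAction.stabilizer_smul_eq_stabilizer_map_conj g x).symm⟩

/-- For each `g`, the condition `g • w = w` is locally constant at the irrational point `z`, so `w ↦
T_w` is Chabauty continuous there; the dense orbit of `x` accumulates at `z`. -/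
theorem stabilizer_mem_closure_conjClass (x : UnitAddCircle) {z : UnitAddCircle}
    (hz : z ∉ rationalPoints) :
    MulAction.stabilizer thompsonT z ∈
      closure[chabauty thompsonT] (conjClass (MulAction.stabilizer thompsonT x)) := by
  classical
  rw [closure_induced, conjClass_stabilizer_eq, Set.image_image]
  refine ContinuousWithinAt.mem_closure_image (ContinuousAt.continuousWithinAt ?_)
    (dense_orbit x z)
  refine tendsto_pi_nhds.2 fun g => tendsto_const_nhds.congr' ?_
  by_cases hg : g • z = z
  · filter_upwards [eventually_smul_eq_self hz hg] with w hw
    simp [MulAction.mem_stabilizer_iff, hg, hw]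
  · have hopen : IsOpen {w : UnitAddCircle | g • w ≠ w} :=
      isOpen_ne_fun (g : UnitAddCircle ≃ₜ UnitAddCircle).continuous continuous_id
    filter_upwards [hopen.mem_nhds hg] with w hw
    have hw' : g • w ≠ w := hw
    simp [MulAction.mem_stabilizer_iff, hg, hw']

theorem closure_conjClass_subset (x : UnitAddCircle) {y : UnitAddCircle}
    (hy : y ∉ rationalPoints) :
    closure[chabauty thompsonT] (conjClass (MulAction.stabilizer thompsonT y)) ⊆
      closure[chabauty thompsonT] (conjClass (MulAction.stabilizer thompsonT x)) := by
  let := chabauty thompsonT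
  refine closure_minimal ?_ isClosed_closure
  rw [conjClass_stabilizer_eq y]
  rintro _ ⟨_, ⟨g, rfl⟩, rfl⟩
  exact stabilizer_mem_closure_conjClass x (smul_notMem_rationalPoints g hy)

theorem weaklyConjugate_stabilizer {x y : UnitAddCircle} (hx : x ∉ rationalPoints)
    (hy : y ∉ rationalPoints) :
    WeaklyConjugate (MulAction.stabilizer thompsonT x) (MulAction.stabilizer thompsonT y) :=
  (closure_conjClass_subset y hx).antisymm (closure_conjClass_subset x hy)

/-! ### Representations induced from stabilizers -/

theorem exists_injective_stabilizer_coset {x y : UnitAddCircle} {g : thompsonT}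
    (hg : g • y ≠ x) : ∃ h : ℕ → MulAction.stabilizer thompsonT x, Function.Injective fun n =>
      ((h n * g : thompsonT) : thompsonT ⧸ MulAction.stabilizer thompsonT y) := by
  obtain ⟨h, hh⟩ := exists_injective_stabilizer_smul hg
  refine ⟨h, fun k l hkl => hh ?_⟩
  have := QuotientGroup.eq.1 hkl
  rw [MulAction.mem_stabilizer_iff, mul_smul, inv_smul_eq_iff, mul_smul, mul_smul] at this
  exact this.symm

section

variable {x y : UnitAddCircle} {K K' : Type*} [NormedAddCommGroup K] [InnerProductSpace ℂ K]
  [FiniteDimensional ℂ K] [NormedAddCommGroup K'] [InnerProductSpace ℂ K']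
  {σ : MulAction.stabilizer thompsonT x →* (K ≃ₗᵢ[ℂ] K)}
  {ρ : MulAction.stabilizer thompsonT y →* (K' ≃ₗᵢ[ℂ] K')}

theorem isIrreducibleRep_ind_stabilizer (hσ : IsIrreducibleRep σ) : IsIrreducibleRep (ind σ) :=
  isIrreducibleRep_ind hσ fun _ hg => exists_injective_stabilizer_coset hg

/-- `B` is a nonzero coefficient of the equivalence. Irreducibility is not involved, so trivial
representations are covered directly. -/
theorem exists_intertwiner_of_unitarilyEquivalent_ind [Nontrivial K]
    (h : UnitarilyEquivalent (ind σ) (ind ρ)) :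
    ∃ (g : thompsonT) (hg : g • x = y) (B : K →ₗ[ℂ] K'), B ≠ 0 ∧
      ∀ l v, B (conjRep g⁻¹ (stabilizer_eq_conj hg) σ l v) = ρ l (B v) := by
  obtain ⟨U, hU⟩ := h
  have : CompleteSpace K := FiniteDimensional.complete ℂ K
  let A : IndSpace σ →L[ℂ] IndSpace ρ := U.toContinuousLinearEquiv
  have hA : ∀ g F, A (ind σ g F) = ind ρ g (A F) := hU
  have hA0 : A ≠ 0 := by
    obtain ⟨F, hF⟩ := @exists_ne _ (nontrivial_indSpace (σ := σ)) 0
    intro h0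
    refine hF (U.injective ?_)
    rw [map_zero]
    exact DFunLike.congr_fun h0 F
  obtain ⟨g, hg⟩ := IndSpace.exists_coeff_ne_zero hA hA0
  have hgy : g • y = x := by
    by_contra hne
    obtain ⟨h, hh⟩ := exists_injective_stabilizer_coset hne
    exact hg (IndSpace.coeff_eq_zero _ hA hh)
  have hgx : g⁻¹ • x = y := inv_smul_eq_iff.2 hgy.symm
  refine ⟨g⁻¹, hgx, _, hg, fun l v => ?_⟩
  have hl : g⁻¹⁻¹ * l * g⁻¹⁻¹⁻¹ ∈ MulAction.stabilizer thompsonT x := by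
    rw [MulAction.mem_stabilizer_iff, inv_inv, mul_smul, hgx, mul_smul, l.2, hgy]
  rw [conjRep_apply _ _ _ _ hl]
  have h1 := IndSpace.coeff_mul_right (A : IndSpace σ →ₗ[ℂ] IndSpace ρ) g l⁻¹ v
  have h2 := IndSpace.coeff_mul_left (A : IndSpace σ →ₗ[ℂ] IndSpace ρ) hA (⟨_, hl⟩⁻¹) g v
  rw [inv_inv] at h1
  rw [inv_inv (⟨_, hl⟩ : MulAction.stabilizer thompsonT x)] at h2
  rw [← h1, ← h2]
  -- Both coefficients are taken at the same element, as `(g l g⁻¹)⁻¹ g = g l⁻¹`.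
  congr 2
  simp [mul_assoc]

end

end

end ThompsonRep

theorem mainTheorem6 (x y : UnitAddCircle) :
    (∀ (K : Type*) [NormedAddCommGroup K] [InnerProductSpace ℂ K] [FiniteDimensional ℂ K]
      (σ : MulAction.stabilizer thompsonT x →* (K ≃ₗᵢ[ℂ] K)),
      IsIrreducibleRep σ → IsIrreducibleRep (ind σ)) ∧
    (∀ (K : Type*) [NormedAddCommGroup K] [InnerProductSpace ℂ K] [FiniteDimensional ℂ K]
      (K' : Type*) [NormedAddCommGroup K'] [InnerProductSpace ℂ K'] [FiniteDimensional ℂ K']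
      (σ : MulAction.stabilizer thompsonT x →* (K ≃ₗᵢ[ℂ] K))
      (ρ : MulAction.stabilizer thompsonT y →* (K' ≃ₗᵢ[ℂ] K')),
      IsIrreducibleRep σ → IsIrreducibleRep ρ →
      (UnitarilyEquivalent (ind σ) (ind ρ) ↔
        ∃ (g : thompsonT) (h : g • x = y),
          UnitarilyEquivalent ρ (conjRep g⁻¹ (stabilizer_eq_conj h) σ))) ∧
    (y ∉ MulAction.orbit thompsonT x →
      ¬ RepEquivalent (MulAction.stabilizer thompsonT x) (MulAction.stabilizer thompsonT y)) ∧
    (x ∉ rationalPoints → y ∉ rationalPoints →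
      WeaklyConjugate (MulAction.stabilizer thompsonT x) (MulAction.stabilizer thompsonT y)) := by
  refine ⟨fun K _ _ _ σ hσ => isIrreducibleRep_ind_stabilizer hσ,
    fun K _ _ _ K' _ _ _ σ ρ hσ hρ => ⟨fun h => ?_, fun ⟨g, hg, h⟩ =>
      unitarilyEquivalent_ind_of_conjRep g (stabilizer_eq_conj hg) h⟩,
    fun hy h => ?_, weaklyConjugate_stabilizer⟩
  · have := hσ.1
    obtain ⟨g, hg, B, hB0, hB⟩ := exists_intertwiner_of_unitarilyEquivalent_ind h
    exact ⟨g, hg, ((isIrreducibleRep_conjRep _ _ hσ).unitarilyEquivalent_of_intertwiner hρ B hB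
      hB0).symm⟩
  -- Quasi-regular representations are induced from the trivial representation on `ℂ`, so only the
  -- existence of `g` matters.
  · obtain ⟨g, hg, -⟩ := exists_intertwiner_of_unitarilyEquivalent_ind h
    exact hy ⟨g, hg⟩
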